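/- Let $n\ge 0$ and let $M$ be an $(n\times n)$-matrix with non-negative integer entries. A square integer matrix $A$ with non-negative entries is called primitive if for some $k\ge 1$ all entries of $A^k$ are positive, and power bounded if the entries of $A^t$ are bounded uniformly in $t\ge 1$. Assume that $M$ is in PB-Frobenius form, i.e. the index set $\{1,\dots,n\}$ can be partitioned into blocks $B_1,\dots,B_r$ (for instance, blocks of consecutive indices) with respect to which $M$ is lower block-triangular, that is $M_{pq}=0$ whenever $p\in B_i$, $q\in B_j$ and $i<j$, and such that every diagonal block $(M_{pq})_{p,q\in B_i}$ is primitive or power bounded. Assume moreover that $M$ is expanding, i.e. for no coordinate vector $\vec e_i$ and no $t\ge 1$ is $M^t\vec e_i=\vec e_i$ or $M^t\vec e_i=\vec 0$. Let $\|\vec x\|=\sum_i|x_i|$ denote the $\ell_1$-norm on $\mathbb R^n$. Then for every vector $\vec v\in\mathbb R^n$ with non-negative entries and $\vec v\ne\vec 0$ the limit $$\vec v_\infty=\lim_{t\to\infty}\frac{1}{\|M^t\vec v\|}\,M^t\vec v$$ exists, $\vec v_\infty\neq\vec 0$, and $\vec v_\infty$ is an eigenvector of $M$, i.e. $M\vec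 v_\infty=\mu\vec v_\infty$ for some $\mu\in\mathbb R$. -/

import Mathlib

open Filter Topology

/-- An integer square matrix is power bounded if the entries of its positive powers are
uniformly bounded. -/
def IsPowerBounded {ι : Type*} [Fintype ι] [DecidableEq ι] (A : Matrix ι ι ℤ) : Prop :=
  ∃ K : ℤ, ∀ t : ℕ, 1 ≤ t → ∀ i j, |(A ^ t) i j| ≤ K

/-- `M` is in PB-Frobenius form: the indices are partitioned into blocks `1, …, r`
(`b i` is the block of the index `i`) such that `M` is lower block-triangular
(`M i j = 0` whenever `b i < b j`) and every diagonal block is primitive or power bounded.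
Blocks of consecutive indices are the case of a monotone `b`. -/
def IsPBFrobeniusForm {n : ℕ} (M : Matrix (Fin n) (Fin n) ℤ) : Prop :=
  ∃ (r : ℕ) (b : Fin n → Fin r),
    M.BlockTriangular (OrderDual.toDual ∘ b) ∧
    ∀ k : Fin r, (M.toSquareBlock b k).IsPrimitive ∨ IsPowerBounded (M.toSquareBlock b k)

/-- `M` is expanding: no coordinate vector is mapped by a positive power of `M` to itself
or to `0`. -/
def IsExpanding {n : ℕ} (M : Matrix (Fin n) (Fin n) ℤ) : Prop :=
  ∀ (i : Fin n) (t : ℕ), 1 ≤ t →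
    (M ^ t).mulVec (Pi.single i 1) ≠ Pi.single i 1 ∧ (M ^ t).mulVec (Pi.single i 1) ≠ 0

/-- The `ℓ₁`-norm on `ℝⁿ`. -/
def l1Norm {n : ℕ} (x : Fin n → ℝ) : ℝ := ∑ i, |x i|

/-- The real matrix with the same entries as the integer matrix `M`. -/
def toRealMatrix {n : ℕ} (M : Matrix (Fin n) (Fin n) ℤ) : Matrix (Fin n) (Fin n) ℝ :=
  M.map (fun a : ℤ => (a : ℝ))

/-! Every coordinate of the orbit is either subexponential or asymptotic to c·μ^t·t^d with μ > 1 and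
c > 0 (`HasGrowth`). The subexponential alternative asserts no asymptotics, since a power bounded
block may permute coordinates periodically; such oscillation is negligible once something grows
exponentially.

The dichotomy is proved by induction over the blocks. By variation of constants
(`mulVec_pow_eq_sum_seqConv`), a coordinate is a finite sum of convolutions of entries of powers of
its diagonal block with the input from earlier blocks. Perron–Frobenius theory makes these entries
bounded or asymptotic to c·λ^t with λ > 1, and `HasGrowth` is stable under nonnegative combinations
and such convolutions; equal rates raise the degree d by one.

Expansion enters only to exclude a subexponential orbit (`IsExpanding.exists_not_subexponential`).
The ℓ₁-norm then has an exact scale μ^t·t^d, every coordinate has a limit at that scale, and the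
limit of the normalized orbit is an eigenvector by continuity. -/

/-! ### Growth types of real sequences -/

/-- The (Cauchy) convolution of two real sequences. -/
def seqConv (a f : ℕ → ℝ) (t : ℕ) : ℝ := ∑ s ∈ Finset.range (t + 1), a s * f (t - s)

/-- A sequence grows slower than every exponential of base greater than `1`. -/
def Subexponential (f : ℕ → ℝ) : Prop := ∀ ρ : ℝ, 1 < ρ → Summable fun t : ℕ => f t / ρ ^ t

/-- The sequence `f t` behaves like `c * μ ^ t * t ^ d`. -/
def GrowsLike (f : ℕ → ℝ) (μ : ℝ) (d : ℕ) (c : ℝ) : Prop :=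
  Tendsto (fun t : ℕ => f t / (μ ^ t * (t : ℝ) ^ d)) atTop (𝓝 c)

/-- A sequence is subexponential, or behaves like a positive multiple of `μ ^ t * t ^ d` with
`1 < μ`. -/
def HasGrowth (f : ℕ → ℝ) : Prop :=
  Subexponential f ∨ ∃ μ : ℝ, 1 < μ ∧ ∃ (d : ℕ) (c : ℝ), 0 < c ∧ GrowsLike f μ d c

theorem seqConv_comm (a f : ℕ → ℝ) : seqConv a f = seqConv f a := by
  funext t
  unfold seqConv
  rw [← Finset.sum_range_reflect]
  refine Finset.sum_congr rfl fun s hs => ?_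
  have : s ≤ t := by simpa [Nat.lt_succ_iff] using hs
  have h1 : t + 1 - 1 - s = t - s := by omega
  have h2 : t - (t - s) = s := by omega
  rw [h1, h2, mul_comm]

theorem GrowsLike.add {f g : ℕ → ℝ} {μ : ℝ} {d : ℕ} {c c' : ℝ} (hf : GrowsLike f μ d c)
    (hg : GrowsLike g μ d c') : GrowsLike (fun t => f t + g t) μ d (c + c') := by
  unfold GrowsLike
  simpa only [add_div] using Tendsto.add hf hg

theorem GrowsLike.of_summable {f : ℕ → ℝ} {μ : ℝ} (hf : Summable fun t : ℕ => f t / μ ^ t)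
    (d : ℕ) : GrowsLike f μ d 0 := by
  refine squeeze_zero_norm' ?_ (tendsto_zero_iff_norm_tendsto_zero.1 hf.tendsto_atTop_zero)
  filter_upwards [eventually_ge_atTop 1] with t ht
  have : (1 : ℝ) ≤ (t : ℝ) ^ d := one_le_pow₀ (by exact_mod_cast ht)
  rw [← div_div, norm_div]
  refine div_le_self (norm_nonneg _) ?_
  rwa [Real.norm_of_nonneg (by positivity)]

theorem GrowsLike.of_degree_lt {f : ℕ → ℝ} {μ : ℝ} {d e : ℕ} {c : ℝ} (hf : GrowsLike f μ d c)
    (hde : d < e) : GrowsLike f μ e 0 := by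
  obtain ⟨k, rfl⟩ := Nat.exists_eq_add_of_lt hde
  have h1 : Tendsto (fun t : ℕ => ((t : ℝ) ^ (k + 1))⁻¹) atTop (𝓝 0) :=
    tendsto_inv_atTop_zero.comp
      ((tendsto_pow_atTop (Nat.succ_ne_zero k)).comp tendsto_natCast_atTop_atTop)
  have h2 := Tendsto.mul hf h1
  rw [mul_zero] at h2
  refine h2.congr fun t => ?_
  rw [add_assoc, pow_add (t : ℝ) d, ← mul_assoc, div_mul_eq_div_div _ (μ ^ t * (t : ℝ) ^ d),
    div_eq_mul_inv _ ((t : ℝ) ^ (k + 1))]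

/-- A uniform bound for a sequence with prescribed growth. -/
theorem GrowsLike.exists_bound {f : ℕ → ℝ} {μ : ℝ} {d : ℕ} {c : ℝ}
    (hf : GrowsLike f μ d c) :
    ∃ K : ℝ, 0 ≤ K ∧ ∀ t : ℕ, 1 ≤ t → ∀ u ≤ t, |f u / μ ^ u| ≤ K * (t : ℝ) ^ d := by
  obtain ⟨K, hK⟩ := (Metric.isBounded_range_of_tendsto _ hf).exists_norm_le
  have hK' : ∀ u : ℕ, |f u / (μ ^ u * (u : ℝ) ^ d)| ≤ K := fun u => hK _ ⟨u, rfl⟩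
  -- For d > 0 the quotient at u = 0 is a division by zero with value 0, so K does not control `f
  -- 0`.
  refine ⟨max K |f 0|, le_max_of_le_right (abs_nonneg _), fun t ht u hut => ?_⟩
  have ht1 : (1 : ℝ) ≤ (t : ℝ) ^ d := one_le_pow₀ (by exact_mod_cast ht)
  have hM : 0 ≤ max K |f 0| := le_max_of_le_right (abs_nonneg _)
  rcases Nat.eq_zero_or_pos u with rfl | hu
  · simp only [pow_zero, div_one]
    exact (le_max_right K _).trans (le_mul_of_one_le_right hM ht1)
  · have hu0 : (0 : ℝ) < (u : ℝ) ^ d := by positivity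
    have h := hK' u
    rw [← div_div, abs_div, abs_of_pos hu0, div_le_iff₀ hu0] at h
    calc _ ≤ K * (u : ℝ) ^ d := h
      _ ≤ max K |f 0| * (t : ℝ) ^ d := by gcongr; exact le_max_left _ _

theorem GrowsLike.summable {f : ℕ → ℝ} {μ ν : ℝ} {d : ℕ} {c : ℝ} (hf : GrowsLike f μ d c)
    (hμ : 0 < μ) (hμν : μ < ν) : Summable fun t : ℕ => f t / ν ^ t := by
  obtain ⟨K, -, hK⟩ := hf.exists_bound
  have hν : 0 < ν := hμ.trans hμν
  have hr : ‖μ / ν‖ < 1 := by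
    rw [Real.norm_of_nonneg (by positivity), div_lt_one hν]; exact hμν
  refine summable_of_isBigO_nat (summable_pow_mul_geometric_of_norm_lt_one d hr)
    (Asymptotics.IsBigO.of_bound K ?_)
  filter_upwards [eventually_ge_atTop 1] with t ht
  have h := hK t ht t le_rfl
  have e : f t / ν ^ t = f t / μ ^ t * (μ / ν) ^ t := by
    rw [div_pow]; field_simp
  rw [e, norm_mul, norm_mul, ← mul_assoc]
  gcongr
  rwa [Real.norm_of_nonneg (by positivity : (0 : ℝ) ≤ (t : ℝ) ^ d)]

/-! ### Asymptotics of convolutions -/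

theorem tendsto_sub_div_self (s : ℕ) :
    Tendsto (fun t : ℕ => ((t - s : ℕ) : ℝ) / t) atTop (𝓝 1) := by
  have h : Tendsto (fun t : ℕ => 1 - (s : ℝ) / t) atTop (𝓝 (1 - 0)) :=
    tendsto_const_nhds.sub (tendsto_const_div_atTop_nhds_zero_nat _)
  rw [sub_zero] at h
  refine h.congr' ?_
  filter_upwards [eventually_ge_atTop (s + 1)] with t ht
  have : (t : ℝ) ≠ 0 := by
    have : 0 < t := by omega
    positivity
  rw [Nat.cast_sub (by omega)]
  field_simp

/-- Convolution with a sequence of smaller exponential growth preserves the growth type. -/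
theorem GrowsLike.seqConv_summable {a f : ℕ → ℝ} {μ : ℝ} {d : ℕ} {c : ℝ} (hμ : 0 < μ)
    (ha : Summable fun t : ℕ => a t / μ ^ t) (hf : GrowsLike f μ d c) :
    GrowsLike (seqConv a f) μ d ((∑' s, a s / μ ^ s) * c) := by
  obtain ⟨K, hK0, hK⟩ := hf.exists_bound
  -- Extending the summands by zero beyond s = t gives series over all of ℕ, so dominated
  -- convergence applies with majorant |a s / μ^s|·K.
  set F : ℕ → ℕ → ℝ := fun t s =>
    if s ≤ t then a s / μ ^ s * (f (t - s) / μ ^ (t - s) / (t : ℝ) ^ d) else 0 with hF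
  have key : Tendsto (fun t => ∑' s, F t s) atTop (𝓝 (∑' s, a s / μ ^ s * c)) := by
    refine tendsto_tsum_of_dominated_convergence (bound := fun s => |a s / μ ^ s| * K)
      (ha.abs.mul_right K) (fun s => ?_) ?_
    · have h1 : Tendsto (fun t : ℕ => t - s) atTop atTop := tendsto_sub_atTop_nat s
      have h2 := (Tendsto.comp hf h1).mul ((tendsto_sub_div_self s).pow d)
      rw [one_pow, mul_one] at h2
      refine (h2.const_mul (a s / μ ^ s)).congr' ?_
      filter_upwards [eventually_ge_atTop (s + 1)] with t ht
      have h3 : ((t - s : ℕ) : ℝ) ≠ 0 := by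
        have : 0 < t - s := by omega
        positivity
      simp only [hF, Function.comp, if_pos (show s ≤ t by omega)]
      rw [div_pow]
      field_simp
    · filter_upwards [eventually_ge_atTop 1] with t ht s
      have ht0 : (0 : ℝ) < (t : ℝ) ^ d := by positivity
      simp only [hF]
      split_ifs with h
      · rw [norm_mul, norm_div _ ((t : ℝ) ^ d), Real.norm_of_nonneg ht0.le]
        refine mul_le_mul_of_nonneg_left ?_ (abs_nonneg _)
        rw [div_le_iff₀ ht0]
        exact hK t ht _ (Nat.sub_le _ _)
      · rw [norm_zero]; positivity
  rw [tsum_mul_right] at key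
  refine key.congr fun t => ?_
  rw [tsum_eq_sum (s := Finset.range (t + 1))]
  · rw [seqConv, Finset.sum_div]
    refine Finset.sum_congr rfl fun s hs => ?_
    have hs : s ≤ t := by simpa [Nat.lt_succ_iff] using hs
    simp only [hF, if_pos hs]
    obtain ⟨u, rfl⟩ := Nat.exists_eq_add_of_le hs
    rw [Nat.add_sub_cancel_left, pow_add, div_div, div_mul_div_comm, mul_assoc]
  · intro s hs
    have : ¬ s ≤ t := by simpa [Nat.lt_succ_iff] using hs
    simp [hF, this]

/-- The Cesàro means of |E| vanish, so t + 1 terms of size at most |E s|·K·t^d add up to o(t^(d+1)).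
This absorbs the error terms below. -/
theorem tendsto_sum_mul_div_pow_zero {E : ℕ → ℝ} (hE : Tendsto E atTop (𝓝 0)) {d : ℕ} {K : ℝ}
    {B : ℕ → ℕ → ℝ} (hB : ∀ t : ℕ, 1 ≤ t → ∀ s ≤ t, |B t s| ≤ K * (t : ℝ) ^ d) :
    Tendsto (fun t : ℕ => (∑ s ∈ Finset.range (t + 1), E s * B t s) / (t : ℝ) ^ (d + 1))
      atTop (𝓝 0) := by
  have h1 : Tendsto (fun t : ℕ => ((t + 1 : ℕ) : ℝ)⁻¹ * ∑ s ∈ Finset.range (t + 1), |E s|)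
      atTop (𝓝 0) := by
    have := (hE.abs.cesaro).comp (tendsto_add_atTop_nat 1)
    simpa [Function.comp_def] using this
  have h2 : Tendsto (fun t : ℕ => 1 + 1 / (t : ℝ)) atTop (𝓝 (1 + 0)) :=
    tendsto_const_nhds.add tendsto_one_div_atTop_nhds_zero_nat
  have h3 := (h1.mul h2).const_mul K
  rw [zero_mul, mul_zero] at h3
  refine squeeze_zero_norm' ?_ h3
  filter_upwards [eventually_ge_atTop 1] with t ht
  have ht0 : (0 : ℝ) < t := by exact_mod_cast ht
  rw [norm_div, Real.norm_of_nonneg (by positivity : (0 : ℝ) ≤ (t : ℝ) ^ (d + 1)),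
    div_le_iff₀ (by positivity)]
  calc ‖∑ s ∈ Finset.range (t + 1), E s * B t s‖
      ≤ ∑ s ∈ Finset.range (t + 1), |E s| * (K * (t : ℝ) ^ d) := by
        refine (norm_sum_le _ _).trans (Finset.sum_le_sum fun s hs => ?_)
        rw [norm_mul]
        exact mul_le_mul_of_nonneg_left
          (hB t ht s (by simpa [Nat.lt_succ_iff] using hs)) (abs_nonneg _)
    _ = _ := by
        rw [← Finset.sum_mul]
        push_cast
        field_simp
        ring

theorem tendsto_choose_div_pow (k : ℕ) :
    Tendsto (fun t : ℕ => (t.choose k : ℝ) / (t : ℝ) ^ k) atTop (𝓝 (k.factorial : ℝ)⁻¹) := by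
  have h := (isEquivalent_choose k)
  rw [Asymptotics.isEquivalent_iff_tendsto_one] at h
  · have h2 := h.mul_const ((k.factorial : ℝ)⁻¹)
    rw [one_mul] at h2
    refine h2.congr fun t => ?_
    have : (k.factorial : ℝ) ≠ 0 := by positivity
    simp only [Pi.div_apply]
    field_simp
  · filter_upwards [eventually_ge_atTop 1] with t ht
    positivity

theorem tendsto_succ_div_self : Tendsto (fun t : ℕ => ((t : ℝ) + 1) / t) atTop (𝓝 1) := by
  have h : Tendsto (fun t : ℕ => 1 + 1 / (t : ℝ)) atTop (𝓝 (1 + 0)) :=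
    tendsto_const_nhds.add tendsto_one_div_atTop_nhds_zero_nat
  rw [add_zero] at h
  refine h.congr' ?_
  filter_upwards [eventually_ge_atTop 1] with t ht
  have ht0 : (t : ℝ) ≠ 0 := by positivity
  field_simp

theorem sum_range_choose_right (t d : ℕ) :
    ∑ s ∈ Finset.range (t + 1), (s.choose d : ℝ) = ((t + 1).choose (d + 1) : ℝ) := by
  induction t with
  | zero => cases d <;> simp [Nat.choose_eq_zero_of_lt]
  | succ t ih =>
    rw [Finset.sum_range_succ, ih, Nat.choose_succ_succ (t + 1) d]
    push_cast
    ring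

/-- Partial sums of a sequence that behaves like `c * t ^ d`. -/
theorem tendsto_sum_div_pow {φ : ℕ → ℝ} {d : ℕ} {c : ℝ}
    (hφ : Tendsto (fun t : ℕ => φ t / (t : ℝ) ^ d) atTop (𝓝 c)) :
    Tendsto (fun t : ℕ => (∑ s ∈ Finset.range (t + 1), φ s) / (t : ℝ) ^ (d + 1)) atTop
      (𝓝 (c / (d + 1))) := by
  have hd0 : (d.factorial : ℝ) ≠ 0 := by positivity
  have hratio : Tendsto (fun t : ℕ => (t : ℝ) / ((t : ℝ) + 1)) atTop (𝓝 1) := by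
    simpa using tendsto_succ_div_self.inv₀ one_ne_zero
  -- The comparison sequence c·d!·binom(t, d) has exact partial sums by the hockey-stick identity.
  -- Dividing by (t + 1)^d instead of t^d keeps the term t = 0 recoverable.
  have hE : Tendsto (fun t : ℕ => (φ t - c * d.factorial * t.choose d) / ((t : ℝ) + 1) ^ d)
      atTop (𝓝 0) := by
    have h1 := (hφ.sub ((tendsto_choose_div_pow d).const_mul (c * d.factorial))).mul
      (hratio.pow d)
    rw [mul_assoc, mul_inv_cancel₀ hd0, mul_one, sub_self, zero_mul] at h1
    refine h1.congr' ?_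
    filter_upwards [eventually_ge_atTop 1] with t ht
    have ht0 : (t : ℝ) ≠ 0 := by positivity
    rw [div_pow]
    field_simp
  have hZ := tendsto_sum_mul_div_pow_zero hE (d := d) (K := 2 ^ d)
    (B := fun _ s => ((s : ℝ) + 1) ^ d) (by
      intro t ht s hs
      have ht' : (1 : ℝ) ≤ t := by exact_mod_cast ht
      have hs' : (s : ℝ) ≤ t := by exact_mod_cast hs
      rw [abs_of_nonneg (by positivity), ← mul_pow]
      gcongr
      linarith)
  have hC : Tendsto (fun t : ℕ => c * d.factorial * ((t + 1).choose (d + 1) : ℝ)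
      / (t : ℝ) ^ (d + 1)) atTop (𝓝 (c / (d + 1))) := by
    have h1 := ((tendsto_choose_div_pow (d + 1)).comp (tendsto_add_atTop_nat 1)).mul
      (tendsto_succ_div_self.pow (d + 1))
    have h2 := h1.const_mul (c * d.factorial)
    have e : c * d.factorial * (((d + 1).factorial : ℝ)⁻¹ * 1 ^ (d + 1)) = c / (d + 1) := by
      rw [Nat.factorial_succ, one_pow]
      push_cast
      have : (d : ℝ) + 1 ≠ 0 := by positivity
      field_simp
    rw [e] at h2
    refine h2.congr' ?_
    filter_upwards [eventually_ge_atTop 1] with t ht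
    have ht0 : (t : ℝ) ≠ 0 := by positivity
    have ht1 : (t : ℝ) + 1 ≠ 0 := by positivity
    simp only [Function.comp]
    push_cast
    rw [div_pow]
    field_simp
  have h := hZ.add hC
  rw [zero_add] at h
  refine h.congr fun t => ?_
  rw [← add_div, ← sum_range_choose_right, Finset.mul_sum, ← Finset.sum_add_distrib]
  congr 1
  refine Finset.sum_congr rfl fun s _ => ?_
  have : ((s : ℝ) + 1) ^ d ≠ 0 := by positivity
  field_simp
  ring

/-- Convolution of two sequences of equal exponential growth raises the polynomial degree. -/
theorem GrowsLike.seqConv_resonant {a f : ℕ → ℝ} {μ : ℝ} {d : ℕ} {c c' : ℝ} (hμ : 0 < μ)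
    (ha : GrowsLike a μ 0 c') (hf : GrowsLike f μ d c) :
    GrowsLike (seqConv a f) μ (d + 1) (c' * (c / (d + 1))) := by
  obtain ⟨K, -, hK⟩ := hf.exists_bound
  -- The rescaled kernel is split as c' plus a null sequence: the constant part yields partial sums
  -- of f / μ^s, the rest is negligible.
  have hE : Tendsto (fun t : ℕ => a t / μ ^ t - c') atTop (𝓝 0) := by
    have h := ha
    unfold GrowsLike at h
    simp only [pow_zero, mul_one] at h
    simpa using h.sub_const c'
  have h1 := tendsto_sum_mul_div_pow_zero hE (d := d) (K := K)
    (B := fun t s => f (t - s) / μ ^ (t - s)) fun t ht s _ => hK t ht _ (Nat.sub_le _ _)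
  have h2 : Tendsto (fun t : ℕ => f t / μ ^ t / (t : ℝ) ^ d) atTop (𝓝 c) := by
    simpa only [div_div, GrowsLike] using hf
  have h := h1.add ((tendsto_sum_div_pow h2).const_mul c')
  rw [zero_add] at h
  refine h.congr fun t => ?_
  have hs : ∑ s ∈ Finset.range (t + 1), f s / μ ^ s
      = ∑ s ∈ Finset.range (t + 1), f (t - s) / μ ^ (t - s) := by
    rw [← Finset.sum_range_reflect]
    simp only [Nat.add_sub_cancel]
  rw [hs, mul_div_assoc', ← add_div, Finset.mul_sum, ← Finset.sum_add_distrib, ← div_div]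
  congr 1
  rw [seqConv, Finset.sum_div]
  refine Finset.sum_congr rfl fun s hs => ?_
  have hs : s ≤ t := by simpa [Nat.lt_succ_iff] using hs
  obtain ⟨u, rfl⟩ := Nat.exists_eq_add_of_le hs
  rw [Nat.add_sub_cancel_left, pow_add]
  field_simp
  ring

/-! ### Stability of growth types -/

theorem GrowsLike.le {f g : ℕ → ℝ} {μ : ℝ} {d : ℕ} {c c' : ℝ} (hμ : 0 < μ)
    (hf : GrowsLike f μ d c) (hg : GrowsLike g μ d c') (hfg : ∀ t, f t ≤ g t) : c ≤ c' :=
  le_of_tendsto_of_tendsto' hf hg fun t => by have := hfg t; gcongr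

theorem Subexponential.growsLike_zero {f : ℕ → ℝ} (hf : Subexponential f) {μ : ℝ} (hμ : 1 < μ)
    (d : ℕ) : GrowsLike f μ d 0 := GrowsLike.of_summable (hf μ hμ) d

theorem Subexponential.add {f g : ℕ → ℝ} (hf : Subexponential f) (hg : Subexponential g) :
    Subexponential fun t => f t + g t := fun ρ hρ => by
  simpa only [add_div] using (hf ρ hρ).add (hg ρ hρ)

theorem Subexponential.zero : Subexponential fun _ => 0 := fun ρ _ => by
  simpa only [zero_div] using summable_zero

theorem Subexponential.of_bounded {f : ℕ → ℝ} {K : ℝ} (hf : ∀ t, |f t| ≤ K) :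
    Subexponential f := fun ρ hρ => by
  have hr : |ρ⁻¹| < 1 := by
    rw [abs_of_pos (by positivity)]; exact inv_lt_one_of_one_lt₀ hρ
  refine Summable.of_norm_bounded ((summable_geometric_of_abs_lt_one hr).mul_left K) fun t => ?_
  rw [div_eq_mul_inv, norm_mul, ← inv_pow, Real.norm_of_nonneg (by positivity : 0 ≤ ρ⁻¹ ^ t)]
  exact mul_le_mul_of_nonneg_right (hf t) (by positivity)

theorem Subexponential.of_le {f g : ℕ → ℝ} (hg : Subexponential g) (hf : ∀ t, 0 ≤ f t)
    (hfg : ∀ t, f t ≤ g t) : Subexponential f := fun ρ hρ =>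
  (hg ρ hρ).of_nonneg_of_le (fun t => div_nonneg (hf t) (by positivity)) fun t => by
    have := hfg t
    gcongr

theorem Subexponential.const_mul {f : ℕ → ℝ} (hf : Subexponential f) (a : ℝ) :
    Subexponential fun t => a * f t := fun ρ hρ => by
  simpa only [mul_div_assoc] using (hf ρ hρ).mul_left a

theorem Subexponential.shift {f : ℕ → ℝ} (hf : Subexponential f) (k : ℕ) :
    Subexponential fun t => f (t + k) := fun ρ hρ => by
  have h := ((summable_nat_add_iff k).2 (hf ρ hρ)).mul_right (ρ ^ k)
  refine h.congr fun t => ?_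
  have : ρ ≠ 0 := by positivity
  rw [pow_add]
  field_simp

theorem Subexponential.of_shift {f : ℕ → ℝ} (hf : Subexponential fun t => f (t + 1)) :
    Subexponential f := fun ρ hρ => by
  rw [← summable_nat_add_iff 1]
  refine ((hf ρ hρ).mul_right ρ⁻¹).congr fun t => ?_
  have : ρ ≠ 0 := by positivity
  rw [pow_succ]
  field_simp

/-- After division by ρ^t this is the Cauchy product of two absolutely convergent series. -/
theorem Subexponential.seqConv {a f : ℕ → ℝ} (ha : Subexponential a) (hf : Subexponential f) :
    Subexponential (seqConv a f) := fun ρ hρ => by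
  have h := summable_norm_sum_mul_range_of_summable_norm (ha ρ hρ).norm (hf ρ hρ).norm
  refine h.of_norm.congr fun t => ?_
  rw [_root_.seqConv, Finset.sum_div]
  refine Finset.sum_congr rfl fun s hs => ?_
  have hs : s ≤ t := by simpa [Nat.lt_succ_iff] using hs
  obtain ⟨u, rfl⟩ := Nat.exists_eq_add_of_le hs
  rw [Nat.add_sub_cancel_left, pow_add, div_mul_div_comm]

theorem GrowsLike.of_shift {f : ℕ → ℝ} {μ : ℝ} {d : ℕ} {c : ℝ} (hμ : 0 < μ)
    (hf : GrowsLike (fun t => f (t + 1)) μ d c) : GrowsLike f μ d (c / μ) := by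
  unfold GrowsLike
  rw [← tendsto_add_atTop_iff_nat 1]
  have hratio : Tendsto (fun t : ℕ => (t : ℝ) / ((t : ℝ) + 1)) atTop (𝓝 1) := by
    simpa using tendsto_succ_div_self.inv₀ one_ne_zero
  have h := (Tendsto.mul hf (hratio.pow d)).mul_const μ⁻¹
  rw [one_pow, mul_one, ← div_eq_mul_inv] at h
  refine h.congr' ?_
  filter_upwards [eventually_ge_atTop 1] with t ht
  have ht0 : (t : ℝ) ≠ 0 := by positivity
  push_cast
  rw [pow_succ, div_pow]
  field_simp

theorem HasGrowth.of_shift {f : ℕ → ℝ} (hf : HasGrowth fun t => f (t + 1)) : HasGrowth f := by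
  rcases hf with hf | ⟨μ, hμ, d, c, hc, hf⟩
  · exact Or.inl hf.of_shift
  · have hμ0 : 0 < μ := by positivity
    exact Or.inr ⟨μ, hμ, d, c / μ, by positivity, hf.of_shift hμ0⟩

theorem HasGrowth.zero : HasGrowth fun _ => 0 := Or.inl Subexponential.zero

/-- Two exponential growth types are comparable. -/
theorem GrowsLike.trichotomy {f g : ℕ → ℝ} {μ ν c c' : ℝ} {d e : ℕ} (hμ : 0 < μ) (hν : 0 < ν)
    (hf : GrowsLike f μ d c) (hg : GrowsLike g ν e c') :
    GrowsLike f ν e 0 ∨ (μ = ν ∧ d = e) ∨ GrowsLike g μ d 0 := by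
  rcases lt_trichotomy μ ν with h | rfl | h
  · exact Or.inl (GrowsLike.of_summable (hf.summable hμ h) e)
  · rcases lt_trichotomy d e with h | rfl | h
    · exact Or.inl (hf.of_degree_lt h)
    · exact Or.inr (Or.inl ⟨rfl, rfl⟩)
    · exact Or.inr (Or.inr (hg.of_degree_lt h))
  · exact Or.inr (Or.inr (GrowsLike.of_summable (hg.summable hν h) d))

/-- Leading constants are positive, so nothing cancels: the dominant scale survives, and equal
scales add their constants. -/
theorem HasGrowth.add {f g : ℕ → ℝ} (hf : HasGrowth f) (hg : HasGrowth g) :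
    HasGrowth fun t => f t + g t := by
  rcases hf with hf | ⟨μ, hμ, d, c, hc, hf⟩
  · rcases hg with hg | ⟨ν, hν, e, c', hc', hg⟩
    · exact Or.inl (hf.add hg)
    · exact Or.inr ⟨ν, hν, e, 0 + c', by simpa, (hf.growsLike_zero hν e).add hg⟩
  · rcases hg with hg | ⟨ν, hν, e, c', hc', hg⟩
    · exact Or.inr ⟨μ, hμ, d, c + 0, by simpa, hf.add (hg.growsLike_zero hμ d)⟩
    · rcases hf.trichotomy (by positivity) (by positivity) hg with h | ⟨rfl, rfl⟩ | h
      · exact Or.inr ⟨ν, hν, e, 0 + c', by simpa, h.add hg⟩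
      · exact Or.inr ⟨μ, hμ, d, c + c', by positivity, hf.add hg⟩
      · exact Or.inr ⟨μ, hμ, d, c + 0, by simpa, hf.add h⟩

theorem HasGrowth.sum {ι : Type*} (s : Finset ι) {f : ι → ℕ → ℝ}
    (hf : ∀ i ∈ s, HasGrowth (f i)) : HasGrowth fun t => ∑ i ∈ s, f i t := by
  classical
  induction s using Finset.induction_on with
  | empty => simpa using HasGrowth.zero
  | insert i s hi ih =>
    simp only [Finset.sum_insert hi]
    exact (hf i (Finset.mem_insert_self i s)).add
      (ih fun j hj => hf j (Finset.mem_insert_of_mem hj))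

theorem HasGrowth.const_mul {f : ℕ → ℝ} (hf : HasGrowth f) {a : ℝ} (ha : 0 ≤ a) :
    HasGrowth fun t => a * f t := by
  rcases ha.eq_or_lt with rfl | ha
  · simpa only [zero_mul] using HasGrowth.zero
  rcases hf with hf | ⟨μ, hμ, d, c, hc, hf⟩
  · exact Or.inl (hf.const_mul a)
  · refine Or.inr ⟨μ, hμ, d, a * c, by positivity, ?_⟩
    unfold GrowsLike
    simpa only [mul_div_assoc] using Tendsto.const_mul a hf

/-- The new leading constant is c·∑ a s / μ^s, positive unless the kernel vanishes identically; that
case is subexponential. -/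
theorem HasGrowth.seqConv_of_summable {a f : ℕ → ℝ} {μ c : ℝ} {d : ℕ} (hμ : 1 < μ)
    (ha0 : ∀ t, 0 ≤ a t) (ha : Summable fun t : ℕ => a t / μ ^ t) (hc : 0 < c)
    (hf : GrowsLike f μ d c) : HasGrowth (seqConv a f) := by
  by_cases h : ∀ t, a t = 0
  · have : seqConv a f = fun _ => 0 := by
      funext t
      simp [seqConv, h]
    rw [this]
    exact HasGrowth.zero
  · push Not at h
    obtain ⟨s, hs⟩ := h
    have hμ0 : 0 < μ := by positivity
    have hs' : 0 < a s := lt_of_le_of_ne (ha0 s) hs.symm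
    have hpos : 0 < ∑' s, a s / μ ^ s :=
      ha.tsum_pos (fun t => div_nonneg (ha0 t) (by positivity)) s (by positivity)
    exact Or.inr ⟨μ, hμ, d, _, by positivity, hf.seqConv_summable hμ0 ha⟩

/-- The convolution of a sequence with prescribed growth with a kernel that is bounded or purely
exponential has a prescribed growth. -/
theorem HasGrowth.seqConv {a f : ℕ → ℝ} (ha0 : ∀ t, 0 ≤ a t) (hf0 : ∀ t, 0 ≤ f t)
    (ha : Subexponential a ∨ ∃ lam : ℝ, 1 < lam ∧ ∃ c : ℝ, 0 < c ∧ GrowsLike a lam 0 c)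
    (hf : HasGrowth f) : HasGrowth (seqConv a f) := by
  rcases ha with ha | ⟨lam, hlam, c', hc', ha⟩
  · rcases hf with hf | ⟨μ, hμ, d, c, hc, hf⟩
    · exact Or.inl (ha.seqConv hf)
    · exact seqConv_of_summable hμ ha0 (ha μ hμ) hc hf
  · rcases hf with hf | ⟨μ, hμ, d, c, hc, hf⟩
    · rw [seqConv_comm]
      exact seqConv_of_summable hlam hf0 (hf lam hlam) hc' ha
    · have hμ0 : 0 < μ := by positivity
      have hlam0 : 0 < lam := by positivity
      rcases lt_trichotomy lam μ with h | rfl | h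
      · exact seqConv_of_summable hμ ha0 (ha.summable hlam0 h) hc hf
      · exact Or.inr ⟨lam, hlam, d + 1, _, by positivity, ha.seqConv_resonant hlam0 hf⟩
      · rw [seqConv_comm]
        exact seqConv_of_summable hlam hf0 (hf.summable hμ0 h) hc' ha

/-- If `g ≤ f` and `f` grows like `μ ^ t * t ^ d`, then `g` has a limit at that scale. -/
theorem HasGrowth.exists_growsLike_of_le {f g : ℕ → ℝ} {μ c : ℝ} {d : ℕ} (hμ : 1 < μ)
    (hg : HasGrowth g) (hf : GrowsLike f μ d c) (hgf : ∀ t, g t ≤ f t) :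
    ∃ c', GrowsLike g μ d c' := by
  rcases hg with hg | ⟨ν, hν, e, c', hc', hg⟩
  · exact ⟨0, hg.growsLike_zero hμ d⟩
  · rcases hf.trichotomy (by positivity) (by positivity) hg with h | ⟨rfl, rfl⟩ | h
    -- Here f is negligible at the scale of g, so g ≤ f would force c' ≤ 0.
    · exact absurd (hg.le (by positivity) h hgf) (not_le.2 hc')
    · exact ⟨c', hg⟩
    · exact ⟨0, h⟩

/-! ### Perron–Frobenius theory for primitive matrices -/

section PerronFrobenius

variable {ι : Type*} [Fintype ι]

theorem vecMul_pos_of_ne_zero {A : Matrix ι ι ℝ} (hA : ∀ i j, 0 < A i j) {x : ι → ℝ}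
    (hx : ∀ i, 0 ≤ x i) (hx0 : x ≠ 0) (j : ι) : 0 < Matrix.vecMul x A j := by
  obtain ⟨i, hi⟩ := Function.ne_iff.1 hx0
  have hi' : 0 < x i := lt_of_le_of_ne (hx i) (Ne.symm hi)
  exact Finset.sum_pos' (fun l _ => mul_nonneg (hx l) (hA l j).le)
    ⟨i, Finset.mem_univ i, mul_pos hi' (hA i j)⟩

theorem mulVec_nonneg_of_nonneg {N : Matrix ι ι ℝ} (hN0 : ∀ i j, 0 ≤ N i j) {v : ι → ℝ}
    (hv : ∀ i, 0 ≤ v i) (i : ι) : 0 ≤ N.mulVec v i :=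
  Finset.sum_nonneg fun j _ => mul_nonneg (hN0 i j) (hv j)

theorem matrix_pow_nonneg {R : Type*} [Ring R] [PartialOrder R] [IsOrderedRing R]
    [DecidableEq ι] {A : Matrix ι ι R}
    (hA : ∀ i j, 0 ≤ A i j) (t : ℕ) (i j : ι) : 0 ≤ (A ^ t) i j := by
  induction t generalizing i j with
  | zero =>
    rw [pow_zero, Matrix.one_apply]
    split_ifs
    exacts [zero_le_one, le_rfl]
  | succ t ih =>
    rw [pow_succ, Matrix.mul_apply]
    exact Finset.sum_nonneg fun l _ => mul_nonneg (ih i l) (hA l j)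

theorem vecMul_pow_of_left_eigenvector [DecidableEq ι] {A : Matrix ι ι ℝ} {lam : ℝ} {x : ι → ℝ}
    (heig : Matrix.vecMul x A = lam • x) (t : ℕ) :
    Matrix.vecMul x (A ^ t) = lam ^ t • x := by
  induction t with
  | zero => simp
  | succ t ih =>
    rw [pow_succ, ← Matrix.vecMul_vecMul, ih, Matrix.smul_vecMul, heig, smul_smul, pow_succ]

/-- A nonnegative matrix with a positive power has a positive left eigenvector. -/
theorem exists_pos_left_eigenvector [DecidableEq ι] [Nonempty ι] {A : Matrix ι ι ℝ}
    (hA : ∀ i j, 0 ≤ A i j) {k : ℕ} (hk : ∀ i j, 0 < (A ^ k) i j) :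
    ∃ (lam : ℝ) (x : ι → ℝ), 0 ≤ lam ∧ (∀ i, 0 < x i) ∧ Matrix.vecMul x A = lam • x := by
  -- Collatz–Wielandt: the eigenvalue is the largest ρ with ρx ≤ xA for some x in the simplex.
  -- Summing coordinates gives ρ ≤ K, which makes the set of admissible pairs compact.
  set K : ℝ := ∑ j, ∑ i, A i j with hKdef
  set S : Set ((ι → ℝ) × ℝ) := (stdSimplex ℝ ι ×ˢ Set.Icc 0 K) ∩
    {p | ∀ j, p.2 * p.1 j ≤ Matrix.vecMul p.1 A j} with hS
  have hcomp : IsCompact S := by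
    refine ((isCompact_stdSimplex ℝ ι).prod isCompact_Icc).inter_right ?_
    simp only [Set.ofPred_forall]
    refine isClosed_iInter fun j => isClosed_le (by fun_prop) ?_
    simp only [Matrix.vecMul, dotProduct]
    fun_prop
  have hbound : ∀ x ∈ stdSimplex ℝ ι, ∀ ρ : ℝ, (∀ j, ρ * x j ≤ Matrix.vecMul x A j) → ρ ≤ K := by
    intro x hx ρ h
    have h1 : ρ = ∑ j, ρ * x j := by rw [← Finset.mul_sum, hx.2, mul_one]
    rw [h1]
    refine Finset.sum_le_sum fun j _ => (h j).trans (Finset.sum_le_sum fun i _ => ?_)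
    exact mul_le_of_le_one_left (hA i j) (hx.2 ▸ Finset.single_le_sum
      (fun l _ => hx.1 l) (Finset.mem_univ i))
  have hne : S.Nonempty := by
    obtain ⟨i⟩ := ‹Nonempty ι›
    refine ⟨(Pi.single i 1, 0), ⟨single_mem_stdSimplex ℝ i, le_rfl, ?_⟩, fun j => ?_⟩
    · exact Finset.sum_nonneg fun j _ => Finset.sum_nonneg fun i _ => hA i j
    · simpa using hA i j
  obtain ⟨⟨x, lam⟩, ⟨⟨hx, hlam⟩, hxl⟩, hmax⟩ :=
    hcomp.exists_isMaxOn hne (continuous_snd.continuousOn (s := S))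
  simp only [Set.mem_ofPred_eq] at hx hxl hlam
  have hx0 : x ≠ 0 := by
    rintro rfl
    simpa using hx.2
  have heig : Matrix.vecMul x A = lam • x := by
    by_contra hneq
    -- A nonzero defect w ≥ 0 becomes strictly positive after multiplication by A^k, so z = xA^k
    -- leaves room to increase `lam` by ε, against maximality.
    set w : ι → ℝ := Matrix.vecMul x A - lam • x with hw
    have hw0 : w ≠ 0 := sub_ne_zero.2 hneq
    have hwn : ∀ i, 0 ≤ w i := fun i => by
      simpa [hw] using hxl i
    set z : ι → ℝ := Matrix.vecMul x (A ^ k) with hz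
    have hzpos : ∀ j, 0 < z j := vecMul_pos_of_ne_zero hk hx.1 hx0
    have hwpos : ∀ j, 0 < Matrix.vecMul w (A ^ k) j := vecMul_pos_of_ne_zero hk hwn hw0
    have hzw : Matrix.vecMul z A = lam • z + Matrix.vecMul w (A ^ k) := by
      rw [hw, Matrix.sub_vecMul, Matrix.smul_vecMul, hz, Matrix.vecMul_vecMul,
        Matrix.vecMul_vecMul, ← pow_succ, ← pow_succ']
      abel
    obtain ⟨j₀, hj₀⟩ := Finite.exists_min fun j => Matrix.vecMul w (A ^ k) j / z j
    set ε := Matrix.vecMul w (A ^ k) j₀ / z j₀ with hε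
    have hεpos : 0 < ε := div_pos (hwpos j₀) (hzpos j₀)
    have hsum : 0 < ∑ j, z j := Finset.sum_pos (fun j _ => hzpos j) Finset.univ_nonempty
    set y : ι → ℝ := (∑ j, z j)⁻¹ • z with hy
    have hyS : y ∈ stdSimplex ℝ ι := by
      refine ⟨fun j => ?_, ?_⟩
      · have := hzpos j
        simp only [hy, Pi.smul_apply, smul_eq_mul]
        positivity
      · simp only [hy, Pi.smul_apply, smul_eq_mul, ← Finset.mul_sum]
        exact inv_mul_cancel₀ hsum.ne'
    have hyl : ∀ j, (lam + ε) * y j ≤ Matrix.vecMul y A j := by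
      intro j
      have h1 : ε * z j ≤ Matrix.vecMul w (A ^ k) j := (le_div_iff₀ (hzpos j)).1 (hj₀ j)
      have h2 : (lam + ε) * z j ≤ Matrix.vecMul z A j := by
        rw [hzw]
        simp only [Pi.add_apply, Pi.smul_apply, smul_eq_mul]
        linarith
      rw [hy, Matrix.smul_vecMul]
      simp only [Pi.smul_apply, smul_eq_mul]
      rw [mul_left_comm]
      exact mul_le_mul_of_nonneg_left h2 (by positivity)
    have hle : lam + ε ≤ lam :=
      hmax (a := (y, lam + ε))
        ⟨⟨hyS, add_nonneg hlam.1 hεpos.le, hbound y hyS _ hyl⟩, hyl⟩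
    linarith
  refine ⟨lam, x, hlam.1, fun j => lt_of_le_of_ne (hx.1 j) fun h0 => ?_, heig⟩
  have h1 := vecMul_pos_of_ne_zero hk hx.1 hx0 j
  rw [vecMul_pow_of_left_eigenvector heig] at h1
  simp [← h0] at h1

variable {P : Matrix ι ι ℝ}

theorem vecMul_le_iSup (hP : ∀ i j, 0 ≤ P i j) (hsum : ∀ j, ∑ i, P i j = 1) (y : ι → ℝ) (j : ι) :
    Matrix.vecMul y P j ≤ ⨆ i, y i := by
  calc Matrix.vecMul y P j ≤ ∑ i, (⨆ i, y i) * P i j :=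
        Finset.sum_le_sum fun i _ => mul_le_mul_of_nonneg_right
          (le_ciSup (Set.finite_range y).bddAbove i) (hP i j)
    _ = ⨆ i, y i := by rw [← Finset.mul_sum, hsum, mul_one]

theorem iInf_le_vecMul (hP : ∀ i j, 0 ≤ P i j) (hsum : ∀ j, ∑ i, P i j = 1) (y : ι → ℝ) (j : ι) :
    ⨅ i, y i ≤ Matrix.vecMul y P j := by
  calc ⨅ i, y i = ∑ i, (⨅ i, y i) * P i j := by rw [← Finset.mul_sum, hsum, mul_one]
    _ ≤ Matrix.vecMul y P j := Finset.sum_le_sum fun i _ => mul_le_mul_of_nonneg_right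
          (ciInf_le (Set.finite_range y).bddBelow i) (hP i j)

/-- Each new coordinate is an average of y giving weight at least δ to a minimal entry, so it lies
below the maximum by δ times the oscillation. -/
theorem vecMul_le_iSup_sub [Nonempty ι] {δ : ℝ} (hδ0 : 0 ≤ δ) (hδ : ∀ i j, δ ≤ P i j)
    (hsum : ∀ j, ∑ i, P i j = 1) (y : ι → ℝ) (j : ι) :
    Matrix.vecMul y P j ≤ (⨆ i, y i) - δ * ((⨆ i, y i) - ⨅ i, y i) := by
  obtain ⟨m, hm⟩ := exists_eq_ciInf_of_finite (f := y)
  have hle : ∀ i, y i ≤ ⨆ i, y i := fun i => le_ciSup (Set.finite_range y).bddAbove i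
  have h1 : (⨆ i, y i) - Matrix.vecMul y P j = ∑ i, ((⨆ i, y i) - y i) * P i j := by
    simp only [sub_mul, Finset.sum_sub_distrib, ← Finset.mul_sum, hsum, mul_one]
    rfl
  have h2 : ((⨆ i, y i) - y m) * P m j ≤ ∑ i, ((⨆ i, y i) - y i) * P i j :=
    Finset.single_le_sum (f := fun i => ((⨆ i, y i) - y i) * P i j)
      (fun i _ => mul_nonneg (sub_nonneg.2 (hle i)) (hδ0.trans (hδ i j))) (Finset.mem_univ m)
  have h3 : ((⨆ i, y i) - y m) * δ ≤ ((⨆ i, y i) - y m) * P m j :=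
    mul_le_mul_of_nonneg_left (hδ m j) (sub_nonneg.2 (hle m))
  rw [← hm]
  linarith

/-- The rows of the powers of a primitive column-stochastic matrix become constant. -/
theorem exists_tendsto_vecMul_pow [DecidableEq ι] [Nonempty ι] (hP : ∀ i j, 0 ≤ P i j)
    (hsum : ∀ j, ∑ i, P i j = 1) {k : ℕ} (hk : ∀ i j, 0 < (P ^ k) i j) {y : ι → ℝ}
    (hy : ∀ i, 0 ≤ y i) (hy0 : y ≠ 0) :
    ∃ c : ℝ, 0 < c ∧ ∀ j, Tendsto (fun t : ℕ => Matrix.vecMul y (P ^ t) j) atTop (𝓝 c) := by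
  have hsumpow : ∀ (t : ℕ) (j : ι), ∑ i, (P ^ t) i j = 1 := by
    intro t
    induction t with
    | zero => simp [Matrix.one_apply]
    | succ t ih =>
      intro j
      simp only [pow_succ, Matrix.mul_apply]
      rw [Finset.sum_comm]
      simp only [← Finset.sum_mul, ih, one_mul, hsum]
  set z : ℕ → ι → ℝ := fun t => Matrix.vecMul y (P ^ t) with hz
  have hzadd : ∀ t s, z (t + s) = Matrix.vecMul (z t) (P ^ s) := fun t s => by
    simp only [hz, Matrix.vecMul_vecMul, pow_add]
  set hi : ℕ → ℝ := fun t => ⨆ i, z t i with hhi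
  set lo : ℕ → ℝ := fun t => ⨅ i, z t i with hlo
  have hlele : ∀ t j, lo t ≤ z t j := fun t j => ciInf_le (Set.finite_range _).bddBelow j
  have hlehi : ∀ t j, z t j ≤ hi t := fun t j => le_ciSup (Set.finite_range _).bddAbove j
  have hiAnti : Antitone hi := antitone_nat_of_succ_le fun t => by
    refine ciSup_le fun j => ?_
    rw [hzadd, pow_one]
    exact vecMul_le_iSup hP hsum _ _
  have loMono : Monotone lo := monotone_nat_of_le_succ fun t => by
    refine le_ciInf fun j => ?_
    rw [hzadd, pow_one]
    exact iInf_le_vecMul hP hsum _ _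
  obtain ⟨j₀⟩ := id ‹Nonempty ι›
  have hlohi : ∀ t, lo t ≤ hi t := fun t => (hlele t j₀).trans (hlehi t j₀)
  have hiBdd : BddBelow (Set.range hi) :=
    ⟨lo 0, by rintro _ ⟨t, rfl⟩; exact (loMono (Nat.zero_le t)).trans (hlohi t)⟩
  have loBdd : BddAbove (Set.range lo) :=
    ⟨hi 0, by rintro _ ⟨t, rfl⟩; exact (hlohi t).trans (hiAnti (Nat.zero_le t))⟩
  have hiT := tendsto_atTop_ciInf hiAnti hiBdd
  have loT := tendsto_atTop_ciSup loMono loBdd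
  set a := ⨅ t, hi t
  set c := ⨆ t, lo t
  obtain ⟨p, hp⟩ := Finite.exists_min fun p : ι × ι => (P ^ k) p.1 p.2
  set δ := (P ^ k) p.1 p.2
  have hδ : 0 < δ := hk _ _
  have hstep : ∀ t, hi (t + k) ≤ hi t - δ * (hi t - lo t) := fun t => by
    refine ciSup_le fun j => ?_
    rw [hzadd]
    exact vecMul_le_iSup_sub hδ.le (fun i j => hp (i, j)) (hsumpow k) _ _
  -- Passing to the limit in the contraction inequality forces a = c; no rate is needed.
  have hlim : a ≤ a - δ * (a - c) :=
    le_of_tendsto_of_tendsto' (hiT.comp (tendsto_add_atTop_nat k))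
      (hiT.sub ((hiT.sub loT).const_mul δ)) hstep
  have hca : c ≤ a := le_of_tendsto_of_tendsto' loT hiT hlohi
  have hac : a = c := by
    refine le_antisymm ?_ hca
    by_contra hlt
    have := mul_pos hδ (sub_pos.2 (not_le.1 hlt))
    linarith
  rw [hac] at hiT
  refine ⟨c, ?_, fun j => tendsto_of_tendsto_of_tendsto_of_le_of_le loT hiT
    (fun t => hlele t j) fun t => hlehi t j⟩
  obtain ⟨m, hm⟩ := exists_eq_ciInf_of_finite (f := z k)
  calc 0 < z k m := vecMul_pos_of_ne_zero hk hy hy0 m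
    _ = lo k := hm
    _ ≤ c := le_ciSup loBdd k

/-- The entries of the powers of a primitive matrix grow like the powers of its
Perron–Frobenius eigenvalue. -/
theorem exists_growsLike_pow_of_left_eigenvector [DecidableEq ι] [Nonempty ι] {A : Matrix ι ι ℝ}
    (hA : ∀ i j, 0 ≤ A i j) {k : ℕ} (hk : ∀ i j, 0 < (A ^ k) i j) {lam : ℝ} (hlam : 0 < lam)
    {x : ι → ℝ} (hx : ∀ i, 0 < x i) (heig : Matrix.vecMul x A = lam • x) (i j : ι) :
    ∃ c : ℝ, 0 < c ∧ GrowsLike (fun t => (A ^ t) i j) lam 0 c := by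
  -- Conjugating by the diagonal matrix of x and dividing by `lam` makes A column-stochastic.
  set P : Matrix ι ι ℝ := fun i j => x i * A i j / (lam * x j) with hPdef
  have hP : ∀ i j, 0 ≤ P i j := fun i j =>
    div_nonneg (mul_nonneg (hx i).le (hA i j)) (mul_pos hlam (hx j)).le
  have hsum : ∀ j, ∑ i, P i j = 1 := fun j => by
    have h := congrFun heig j
    simp only [Matrix.vecMul, dotProduct, Pi.smul_apply, smul_eq_mul] at h
    simp only [hPdef, ← Finset.sum_div, h]
    exact div_self (mul_pos hlam (hx j)).ne'
  have hpow : ∀ (t : ℕ) i j, (P ^ t) i j = x i * (A ^ t) i j / (lam ^ t * x j) := by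
    intro t
    induction t with
    | zero =>
      intro i j
      simp only [pow_zero, Matrix.one_apply, one_mul]
      split_ifs with h
      · rw [h, mul_one, div_self (hx j).ne']
      · simp
    | succ t ih =>
      intro i j
      rw [pow_succ, pow_succ, Matrix.mul_apply, Matrix.mul_apply, Finset.mul_sum, Finset.sum_div]
      refine Finset.sum_congr rfl fun l _ => ?_
      rw [ih]
      simp only [hPdef]
      have h1 := (hx l).ne'
      have h2 := (hx j).ne'
      rw [pow_succ]
      field_simp
  obtain ⟨c, hc, h⟩ := exists_tendsto_vecMul_pow hP hsum (k := k)
    (fun i j => by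
      rw [hpow]
      have := hx i
      have := hx j
      have := hk i j
      positivity)
    (y := Pi.single i 1) (fun l => by
      by_cases h : l = i
      · subst h; simp
      · simp [h])
    (by simp)
  have hi := hx i
  have hj := hx j
  refine ⟨c * (x j / x i), by positivity, ?_⟩
  refine ((h j).mul_const (x j / x i)).congr fun t => ?_
  rw [Matrix.single_one_vecMul]
  simp only [Matrix.row, hpow]
  field_simp

end PerronFrobenius

/-- A primitive integer matrix is power bounded, or the entries of its powers grow exponentially
at a common rate. -/
theorem isPowerBounded_or_growsLike_of_isPrimitive {ι : Type*} [Fintype ι] [DecidableEq ι]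
    {A : Matrix ι ι ℤ} (hA : A.IsPrimitive) :
    IsPowerBounded A ∨ ∃ lam : ℝ, 1 < lam ∧ ∀ i j, ∃ c : ℝ, 0 < c ∧
      GrowsLike (fun t => ((A ^ t) i j : ℝ)) lam 0 c := by
  rcases isEmpty_or_nonempty ι with h | h
  · exact Or.inl ⟨0, fun t _ i => isEmptyElim i⟩
  obtain ⟨k, -, hk⟩ := hA.exists_pos_pow
  set B : Matrix ι ι ℝ := A.map (Int.castRingHom ℝ) with hB
  have hpow : ∀ (t : ℕ) i j, (B ^ t) i j = ((A ^ t) i j : ℝ) := fun t i j => by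
    rw [hB, ← Matrix.map_pow]
    rfl
  have hB0 : ∀ i j, 0 ≤ B i j := fun i j => by
    simpa [hB] using hA.nonneg i j
  have hBk : ∀ i j, 0 < (B ^ k) i j := fun i j => by
    rw [hpow]
    exact_mod_cast hk i j
  obtain ⟨lam, x, hlam, hx, heig⟩ := exists_pos_left_eigenvector hB0 hBk
  rcases le_or_gt lam 1 with hle | hlt
  · left
    -- For `lam` ≤ 1 the relation xA^t = lam^t·x bounds (A^t) i j by x j / x i, and p maximizes this
    -- ratio.
    obtain ⟨p, hp⟩ := Finite.exists_max fun p : ι × ι => x p.2 / x p.1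
    refine ⟨⌈x p.2 / x p.1⌉, fun t _ i j => ?_⟩
    rw [abs_of_nonneg (matrix_pow_nonneg hA.nonneg t i j)]
    have h1 : x i * (B ^ t) i j ≤ x j := by
      calc x i * (B ^ t) i j ≤ Matrix.vecMul x (B ^ t) j :=
            Finset.single_le_sum (f := fun i => x i * (B ^ t) i j)
              (fun l _ => mul_nonneg (hx l).le (matrix_pow_nonneg hB0 t l j)) (Finset.mem_univ i)
        _ = lam ^ t * x j := by
            rw [vecMul_pow_of_left_eigenvector heig]; rfl
        _ ≤ x j := mul_le_of_le_one_left (hx j).le (pow_le_one₀ hlam hle)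
    have h2 : ((A ^ t) i j : ℝ) ≤ x j / x i := by
      rw [← hpow, le_div_iff₀ (hx i), mul_comm]
      exact h1
    exact_mod_cast (h2.trans (hp (i, j))).trans (Int.le_ceil _)
  · right
    refine ⟨lam, hlt, fun i j => ?_⟩
    obtain ⟨c, hc, h⟩ := exists_growsLike_pow_of_left_eigenvector hB0 hBk
      (by positivity) hx heig i j
    exact ⟨c, hc, by simpa only [hpow] using h⟩

/-! ### Block-triangular recursions -/

section BlockTriangular

variable {ι β : Type*} [Fintype ι] [DecidableEq ι] [LinearOrder β] {b : ι → β}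

/-- A nonzero summand needs b j ≤ b l ≤ b i, so paths between indices of one block never leave it.
-/
theorem BlockTriangular.pow_succ_apply {R : Type*} [Ring R] {N : Matrix ι ι R}
    (hN : N.BlockTriangular (OrderDual.toDual ∘ b)) {i j : ι} (hij : b i = b j) (t : ℕ) :
    (N ^ (t + 1)) i j = ∑ l with b l = b i, N i l * (N ^ t) l j := by
  rw [pow_succ', Matrix.mul_apply, Finset.sum_filter_of_ne]
  intro l _ hl
  rcases lt_trichotomy (b l) (b i) with h | h | h
  · exact absurd (by rw [hN.pow t (hij ▸ h : b l < b j), mul_zero]) hl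
  · exact h
  · exact absurd (by rw [hN h, zero_mul]) hl

/-- The powers of a diagonal block are the diagonal blocks of the powers. -/
theorem BlockTriangular.toSquareBlock_pow_apply {R : Type*} [Ring R] {N : Matrix ι ι R}
    (hN : N.BlockTriangular (OrderDual.toDual ∘ b)) (k : β) (t : ℕ) (p q : {a // b a = k}) :
    (N.toSquareBlock b k ^ t) p q = (N ^ t) p q := by
  induction t generalizing p q with
  | zero => simp [Matrix.one_apply, Subtype.ext_iff]
  | succ t ih =>
    rw [pow_succ_apply hN (p.2.trans q.2.symm), pow_succ', Matrix.mul_apply,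
      Finset.sum_subtype (p := fun a => b a = k) (Finset.univ.filter fun l => b l = b p) (by
        intro x; simp [p.2])]
    exact Finset.sum_congr rfl fun l _ => by rw [ih]; rfl

/-- The input received by the coordinate `i` at time `t`: the initial value at time `0`, and then
the contributions of the coordinates in the preceding blocks. -/
def blockInput (N : Matrix ι ι ℝ) (b : ι → β) (v : ι → ℝ) (i : ι) : ℕ → ℝ
  | 0 => v i
  | t + 1 => ∑ l with b l < b i, N i l * (N ^ t).mulVec v l

/-- Variation of constants for block-triangular linear recursions. -/
theorem mulVec_pow_eq_sum_seqConv {N : Matrix ι ι ℝ}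
    (hN : N.BlockTriangular (OrderDual.toDual ∘ b)) (v : ι → ℝ) (t : ℕ) (i : ι) :
    (N ^ t).mulVec v i =
      ∑ j with b j = b i, seqConv (fun s => (N ^ s) i j) (blockInput N b v j) t := by
  induction t generalizing i with
  | zero =>
    simp only [seqConv, zero_add, Finset.sum_range_one, pow_zero, Matrix.one_mulVec,
      Nat.sub_zero, blockInput, Matrix.one_apply, ite_mul, one_mul, zero_mul]
    rw [Finset.sum_ite_eq, if_pos (by simp)]
  | succ t ih =>
    have hR : ∀ j ∈ Finset.univ.filter (fun j => b j = b i),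
        seqConv (fun s => (N ^ s) i j) (blockInput N b v j) (t + 1) =
          (∑ l with b l = b i, N i l * seqConv (fun s => (N ^ s) l j) (blockInput N b v j) t)
            + (1 : Matrix ι ι ℝ) i j * blockInput N b v j (t + 1) := by
      intro j hj
      have hj : b i = b j := by simpa using (Finset.mem_filter.1 hj).2.symm
      -- The split-off term s = 0 carries the fresh input at time t + 1; in the others one factor N
      -- acts inside the block.
      rw [seqConv, Finset.sum_range_succ']
      congr 1
      simp only [seqConv, Finset.mul_sum]
      rw [Finset.sum_comm]
      refine Finset.sum_congr rfl fun s _ => ?_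
      rw [BlockTriangular.pow_succ_apply hN hj, Finset.sum_mul, Nat.add_sub_add_right]
      exact Finset.sum_congr rfl fun l _ => mul_assoc _ _ _
    rw [Finset.sum_congr rfl hR, Finset.sum_add_distrib, Finset.sum_comm]
    have h1 : ∑ j with b j = b i, (1 : Matrix ι ι ℝ) i j * blockInput N b v j (t + 1)
        = ∑ l with b l < b i, N i l * (N ^ t).mulVec v l := by
      simp only [Matrix.one_apply, ite_mul, one_mul, zero_mul]
      rw [Finset.sum_ite_eq, if_pos (by simp)]
      rfl
    have h2 : ∀ l ∈ Finset.univ.filter (fun l => b l = b i),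
        ∑ j with b j = b i, N i l * seqConv (fun s => (N ^ s) l j) (blockInput N b v j) t
          = N i l * (N ^ t).mulVec v l := by
      intro l hl
      rw [ih, (Finset.mem_filter.1 hl).2, Finset.mul_sum]
    rw [h1, Finset.sum_congr rfl h2, pow_succ', ← Matrix.mulVec_mulVec]
    rw [← Finset.sum_union (Finset.disjoint_filter.2 fun l _ h h' => h'.ne h),
      ← Finset.filter_or, Finset.sum_filter_of_ne]
    · rfl
    · intro l _ hl
      by_contra hcon
      rw [← le_iff_eq_or_lt, not_le] at hcon
      exact hl (by rw [hN hcon, zero_mul])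

/-- The coordinates of the orbit of a nonnegative vector have a growth type if the entries of the
powers of the diagonal blocks are subexponential or purely exponential. -/
theorem hasGrowth_mulVec_pow [WellFoundedLT β] {N : Matrix ι ι ℝ} (hN0 : ∀ i j, 0 ≤ N i j)
    (hN : N.BlockTriangular (OrderDual.toDual ∘ b))
    (hker : ∀ i j, b i = b j → (Subexponential fun t => (N ^ t) i j) ∨
      ∃ lam : ℝ, 1 < lam ∧ ∃ c : ℝ, 0 < c ∧ GrowsLike (fun t => (N ^ t) i j) lam 0 c)
    {v : ι → ℝ} (hv : ∀ i, 0 ≤ v i) (i : ι) : HasGrowth fun t => (N ^ t).mulVec v i := by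
  induction hk : b i using WellFoundedLT.induction generalizing i with
  | ind k ih =>
  have hx0 : ∀ t l, 0 ≤ (N ^ t).mulVec v l := fun t =>
    mulVec_nonneg_of_nonneg (matrix_pow_nonneg hN0 t) hv
  simp only [mulVec_pow_eq_sum_seqConv hN v]
  refine HasGrowth.sum _ fun j hj => ?_
  have hj : b j = b i := (Finset.mem_filter.1 hj).2
  refine HasGrowth.seqConv (fun t => matrix_pow_nonneg hN0 t i j) (fun t => ?_)
    (hker i j hj.symm) ?_
  · cases t with
    | zero => exact hv j
    | succ t => exact Finset.sum_nonneg fun l _ => mul_nonneg (hN0 j l) (hx0 t l)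
  -- The input at time 0 is exceptional; after a shift it is a nonnegative combination of
  -- coordinates in strictly smaller blocks, covered by induction.
  · refine HasGrowth.of_shift (HasGrowth.sum _ fun l hl => ?_)
    have hl : b l < b j := (Finset.mem_filter.1 hl).2
    exact (ih (b l) (by rw [← hk, ← hj]; exact hl) l rfl).const_mul (hN0 j l)

end BlockTriangular

/-! ### Consequences of expansion -/

section Expanding

variable {n : ℕ} {M : Matrix (Fin n) (Fin n) ℤ}

theorem IsExpanding.exists_ne_zero (hexp : IsExpanding M) (i : Fin n) {t : ℕ} (ht : 1 ≤ t) :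
    ∃ l, (M ^ t) l i ≠ 0 := by
  have h := (hexp i t ht).2
  rw [Matrix.mulVec_single_one] at h
  exact Function.ne_iff.1 h

/-- For an expanding nonnegative matrix no column of its powers stays bounded. -/
theorem IsExpanding.not_bounded (hexp : IsExpanding M) (hM : ∀ i j, 0 ≤ M i j) (j : Fin n)
    (K : ℤ) : ¬ ∀ t : ℕ, 1 ≤ t → ∀ i, |(M ^ t) i j| ≤ K := by
  intro hK
  have hpow := matrix_pow_nonneg hM
  have hmaps : ∀ t : ℕ, (fun i => (M ^ (t + 1)) i j) ∈
      Set.Icc (fun _ : Fin n => -K) (fun _ => K) := fun t =>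
    ⟨fun i => (abs_le.1 (hK _ (Nat.le_add_left 1 t) i)).1,
      fun i => (abs_le.1 (hK _ (Nat.le_add_left 1 t) i)).2⟩
  -- Only finitely many integer columns satisfy the bound, so one recurs and is fixed by a positive
  -- power Q of M.
  obtain ⟨s, t, hst, heq⟩ : ∃ s t : ℕ, s < t ∧
      (fun i => (M ^ (s + 1)) i j) = fun i => (M ^ (t + 1)) i j := by
    obtain ⟨s, -, t, -, hne, h⟩ := Set.infinite_univ.exists_ne_map_eq_of_mapsTo
      (fun t _ => hmaps t) (Set.finite_Icc _ _)
    rcases lt_or_gt_of_ne hne with h' | h'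
    exacts [⟨s, t, h', h⟩, ⟨t, s, h', h.symm⟩]
  obtain ⟨p, rfl⟩ := Nat.exists_eq_add_of_lt hst
  set x : Fin n → ℤ := fun i => (M ^ (s + 1)) i j with hx
  set Q := M ^ (p + 1) with hQ
  have hfix : Q.mulVec x = x := by
    conv_rhs => rw [heq]
    funext i
    rw [show s + p + 1 + 1 = (p + 1) + (s + 1) by ring, pow_add, Matrix.mul_apply]
    rfl
  have hx0 : ∀ i, 0 ≤ x i := fun i => hpow _ _ _
  have hcol : ∀ l, 1 ≤ ∑ i, Q i l := fun l => by
    obtain ⟨m, hm⟩ := hexp.exists_ne_zero l (Nat.le_add_left 1 p)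
    have hm' : 1 ≤ Q m l := lt_of_le_of_ne (hpow _ _ _) hm.symm
    exact hm'.trans (Finset.single_le_sum (f := fun i => Q i l)
      (fun i _ => hpow _ _ _) (Finset.mem_univ m))
  -- Since Qx = x preserves total mass and all column sums of Q are at least 1, those over the
  -- support of x equal 1. These columns are then unit vectors, and Q induces a self-map σ of the
  -- support.
  have hcol1 : ∀ l, 0 < x l → ∑ i, Q i l = 1 := by
    have hs : ∑ l, ((∑ i, Q i l) - 1) * x l = 0 := by
      simp only [sub_mul, one_mul, Finset.sum_sub_distrib, Finset.sum_mul]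
      rw [Finset.sum_comm, sub_eq_zero]
      exact Finset.sum_congr rfl fun i _ => congrFun hfix i
    intro l hl
    have h := (Finset.sum_eq_zero_iff_of_nonneg fun l _ =>
      mul_nonneg (sub_nonneg.2 (hcol l)) (hx0 l)).1 hs l (Finset.mem_univ l)
    rcases mul_eq_zero.1 h with h | h
    · exact sub_eq_zero.1 h
    · exact absurd h hl.ne'
  have hunit : ∀ l : {l // 0 < x l}, ∃ m : {l // 0 < x l},
      Q.mulVec (Pi.single l.1 1) = Pi.single m.1 1 := by
    rintro ⟨l, hl⟩
    obtain ⟨m, hm⟩ := hexp.exists_ne_zero l (Nat.le_add_left 1 p)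
    have hm' : 1 ≤ Q m l := lt_of_le_of_ne (hpow _ _ _) (Ne.symm hm)
    have hsum := hcol1 l hl
    rw [← Finset.add_sum_erase _ _ (Finset.mem_univ m)] at hsum
    have hrest : 0 ≤ ∑ i ∈ Finset.univ.erase m, Q i l := Finset.sum_nonneg fun i _ => hpow _ _ _
    have hz := (Finset.sum_eq_zero_iff_of_nonneg (s := Finset.univ.erase m)
      (f := fun i => Q i l) fun i _ => hpow _ _ _).1 (by omega)
    refine ⟨⟨m, ?_⟩, ?_⟩
    · calc 0 < Q m l * x l := mul_pos (by omega) hl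
        _ ≤ Q.mulVec x m := Finset.single_le_sum (f := fun l => Q m l * x l)
            (fun i _ => mul_nonneg (hpow _ _ _) (hx0 i)) (Finset.mem_univ l)
        _ = x m := by rw [hfix]
    · rw [Matrix.mulVec_single_one]
      funext i
      by_cases him : i = m
      · subst him
        simp only [Matrix.col_apply, Pi.single_eq_same]
        omega
      · simpa [him] using hz i (Finset.mem_erase.2 ⟨him, Finset.mem_univ i⟩)
  choose σ hσ using hunit
  have hiter : ∀ (q : ℕ) l, (Q ^ q).mulVec (Pi.single l.1 1) = Pi.single (σ^[q] l).1 1 := by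
    intro q
    induction q with
    | zero =>
      intro l
      rw [pow_zero, Matrix.one_mulVec]
      rfl
    | succ q ih =>
      intro l
      rw [pow_succ, ← Matrix.mulVec_mulVec, hσ, ih, Function.iterate_succ_apply]
  obtain ⟨l, hl⟩ := hexp.exists_ne_zero j (Nat.le_add_left 1 s)
  have hl' : 0 < x l := lt_of_le_of_ne (hx0 l) (Ne.symm hl)
  -- A self-map of a finite set has a periodic point, giving a coordinate vector fixed by a positive
  -- power of M.
  obtain ⟨u, w, huw, he⟩ : ∃ u w : ℕ, u < w ∧ σ^[u] ⟨l, hl'⟩ = σ^[w] ⟨l, hl'⟩ := by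
    obtain ⟨u, w, hne, h⟩ := Finite.exists_ne_map_eq_of_infinite fun u : ℕ => σ^[u] ⟨l, hl'⟩
    rcases lt_or_gt_of_ne hne with h' | h'
    exacts [⟨u, w, h', h⟩, ⟨w, u, h', h.symm⟩]
  obtain ⟨q, rfl⟩ := Nat.exists_eq_add_of_lt huw
  rw [show u + q + 1 = (q + 1) + u by ring, Function.iterate_add_apply] at he
  have h := hiter (q + 1) (σ^[u] ⟨l, hl'⟩)
  rw [← he, hQ, ← pow_mul] at h
  exact (hexp _ _ (Nat.mul_pos (Nat.succ_pos p) (Nat.succ_pos q))).1 h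

/-- Every column of the powers of an expanding block-triangular nonnegative matrix whose diagonal
blocks are power bounded or grow exponentially has a coordinate of exponential growth. -/
theorem IsExpanding.exists_not_subexponential {β : Type*} [LinearOrder β] (hexp : IsExpanding M)
    (hM : ∀ i j, 0 ≤ M i j) {b : Fin n → β}
    (htri : M.BlockTriangular (OrderDual.toDual ∘ b))
    (hblock : ∀ k, IsPowerBounded (M.toSquareBlock b k) ∨ ∃ lam : ℝ, 1 < lam ∧
      ∀ i j, ∃ c : ℝ, 0 < c ∧
        GrowsLike (fun t => ((M.toSquareBlock b k ^ t) i j : ℝ)) lam 0 c) (i : Fin n) :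
    ∃ l, ¬ Subexponential fun t => ((M ^ t) l i : ℝ) := by
  have hpow := matrix_pow_nonneg hM
  have hmul : ∀ s t l j, (M ^ s) l j * (M ^ t) j i ≤ (M ^ (s + t)) l i := fun s t l j => by
    rw [pow_add, Matrix.mul_apply]
    exact Finset.single_le_sum (f := fun j => (M ^ s) l j * (M ^ t) j i)
      (fun j _ => mul_nonneg (hpow _ _ _) (hpow _ _ _)) (Finset.mem_univ j)
  -- The index j is chosen in the last block reachable from i. Nothing beyond that block is
  -- reachable from j, so a power bounded block would leave column j bounded.
  obtain ⟨j, ⟨t₀, hj⟩, hmax⟩ := Set.exists_max_image {l | ∃ t : ℕ, (M ^ t) l i ≠ 0} b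
    (Set.toFinite _) ⟨i, 0, by simp⟩
  have hj' : 1 ≤ (M ^ t₀) j i := lt_of_le_of_ne (hpow _ _ _) (Ne.symm hj)
  rcases hblock (b j) with ⟨K, hK⟩ | ⟨lam, hlam, hg⟩
  · refine absurd (fun t ht l => ?_) (hexp.not_bounded hM j |K|)
    rcases lt_trichotomy (b l) (b j) with h | h | h
    · rw [htri.pow t (h : b l < b j), abs_zero]
      exact abs_nonneg K
    · have := hK t ht ⟨l, h⟩ ⟨j, rfl⟩
      rw [BlockTriangular.toSquareBlock_pow_apply htri] at this
      exact this.trans (le_abs_self K)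
    · have hzero : (M ^ t) l j = 0 := by
        by_contra hne
        have hpos : 0 < (M ^ t) l j := lt_of_le_of_ne (hpow _ _ _) (Ne.symm hne)
        refine absurd (hmax l ⟨t + t₀, ?_⟩) (not_le.2 h)
        exact ((mul_pos hpos (by omega)).trans_le (hmul t t₀ l j)).ne'
      rw [hzero, abs_zero]
      exact abs_nonneg K
  · refine ⟨j, fun hsub => ?_⟩
    obtain ⟨c, hc, hgrow⟩ := hg ⟨j, rfl⟩ ⟨j, rfl⟩
    simp only [BlockTriangular.toSquareBlock_pow_apply htri] at hgrow
    have hle : Subexponential fun t => ((M ^ t) j j : ℝ) :=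
      (hsub.shift t₀).of_le (fun t => by exact_mod_cast hpow t j j) fun t => by
        have h := (le_mul_of_one_le_right (hpow t j j) hj').trans (hmul t t₀ j j)
        exact_mod_cast h
    exact hc.not_ge (hgrow.le (by positivity) (hle.growsLike_zero hlam 0) fun _ => le_rfl)

end Expanding

/-! ### Convergence of the normalized orbit -/

/-- If every coordinate of the orbit of a nonnegative vector under a nonnegative matrix has a growth
type, and the orbit grows exponentially, then the normalized orbit converges to an eigenvector. -/
theorem exists_tendsto_normalized_orbit {n : ℕ} {N : Matrix (Fin n) (Fin n) ℝ}
    (hN0 : ∀ i j, 0 ≤ N i j) {v : Fin n → ℝ} (hv : ∀ i, 0 ≤ v i)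
    (hgrow : ∀ i, HasGrowth fun t => (N ^ t).mulVec v i)
    (hexp : ¬ Subexponential fun t => ∑ i, (N ^ t).mulVec v i) :
    ∃ w : Fin n → ℝ,
      Tendsto (fun t : ℕ => (1 / l1Norm ((N ^ t).mulVec v)) • (N ^ t).mulVec v) atTop (𝓝 w) ∧
      w ≠ 0 ∧ ∃ μ : ℝ, Module.End.HasEigenvector (Matrix.toLin' N) μ w := by
  set x : ℕ → Fin n → ℝ := fun t => (N ^ t).mulVec v with hx
  have hx0 : ∀ t i, 0 ≤ x t i := fun t =>
    mulVec_nonneg_of_nonneg (matrix_pow_nonneg hN0 t) hv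
  set f : ℕ → ℝ := fun t => ∑ i, x t i with hf
  have hnorm : ∀ t, l1Norm (x t) = f t := fun t =>
    Finset.sum_congr rfl fun i _ => abs_of_nonneg (hx0 t i)
  obtain ⟨μ, hμ, d, c, hc, hfg⟩ := (HasGrowth.sum Finset.univ fun i _ => hgrow i).resolve_left hexp
  have hle : ∀ i t, x t i ≤ f t := fun i t =>
    Finset.single_le_sum (fun j _ => hx0 t j) (Finset.mem_univ i)
  choose u hu using fun i => (hgrow i).exists_growsLike_of_le hμ hfg (hle i)
  have hfpos : ∀ᶠ t in atTop, f t ≠ 0 := by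
    filter_upwards [(show Tendsto _ _ _ from hfg).eventually (lt_mem_nhds hc)] with t ht h0
    have ht' : 0 < f t / (μ ^ t * (t : ℝ) ^ d) := ht
    rw [h0, zero_div] at ht'
    exact lt_irrefl _ ht'
  set y : ℕ → Fin n → ℝ := fun t => (1 / f t) • x t with hy
  have hlim : Tendsto y atTop (𝓝 fun i => u i / c) := by
    refine tendsto_pi_nhds.2 fun i => ((hu i).div hfg hc.ne').congr' ?_
    filter_upwards [eventually_ge_atTop 1] with t ht
    have h1 : μ ^ t * (t : ℝ) ^ d ≠ 0 := by positivity
    simp only [hy, Pi.smul_apply, smul_eq_mul]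
    rw [one_div, inv_mul_eq_div]
    exact div_div_div_cancel_right₀ h1 _ _
  set w : Fin n → ℝ := fun i => u i / c
  have hysum : ∀ᶠ t in atTop, ∑ i, y t i = 1 := by
    filter_upwards [hfpos] with t ht
    simp only [hy, Pi.smul_apply, smul_eq_mul, ← Finset.mul_sum]
    exact one_div_mul_cancel ht
  have hcont : Continuous fun z : Fin n → ℝ => ∑ i, z i := by fun_prop
  have hwsum : ∑ i, w i = 1 :=
    tendsto_nhds_unique ((hcont.tendsto w).comp hlim)
      (tendsto_const_nhds.congr' (hysum.mono fun t ht => ht.symm))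
  have hw0 : w ≠ 0 := by
    intro h0
    simp [h0] at hwsum
  have hNlim : Tendsto (fun t => N.mulVec (y t)) atTop (𝓝 (N.mulVec w)) :=
    ((continuous_const.matrix_mulVec continuous_id).tendsto w).comp hlim
  -- Summing coordinates identifies the factor f (t + 1) / f t with the mass of N y_t, since y_(t+1)
  -- has mass 1; hence the factor converges and the limit is an eigenvector.
  have hstep : ∀ᶠ t in atTop, N.mulVec (y t) = (f (t + 1) / f t) • y (t + 1) := by
    filter_upwards [(tendsto_add_atTop_nat 1).eventually hfpos] with t ht
    simp only [hy, hx, Matrix.mulVec_smul, Matrix.mulVec_mulVec, ← pow_succ', smul_smul]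
    congr 1
    field_simp
  have hratio : Tendsto (fun t => f (t + 1) / f t) atTop (𝓝 (∑ i, N.mulVec w i)) := by
    refine ((hcont.tendsto _).comp hNlim).congr' ?_
    filter_upwards [hstep, (tendsto_add_atTop_nat 1).eventually hysum] with t h1 h2
    simp only [Function.comp, h1, Pi.smul_apply, smul_eq_mul, ← Finset.mul_sum, h2, mul_one]
  have heig : N.mulVec w = (∑ i, N.mulVec w i) • w :=
    tendsto_nhds_unique hNlim ((hratio.smul (hlim.comp (tendsto_add_atTop_nat 1))).congr'
      (hstep.mono fun t ht => ht.symm))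
  refine ⟨w, ?_, hw0, ∑ i, N.mulVec w i, Module.End.hasEigenvector_iff.2
    ⟨Module.End.mem_eigenspace_iff.2 ?_, hw0⟩⟩
  · exact hlim.congr fun t => by simp only [hy, ← hnorm, hx]
  · rwa [Matrix.toLin'_apply]

theorem theorem1p1 {n : ℕ} (M : Matrix (Fin n) (Fin n) ℤ)
    (hnonneg : ∀ i j, 0 ≤ M i j)
    (hform : IsPBFrobeniusForm M)
    (hexp : IsExpanding M)
    (v : Fin n → ℝ) (hv : ∀ i, 0 ≤ v i) (hv0 : v ≠ 0) :
    ∃ w : Fin n → ℝ,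
      Tendsto (fun t : ℕ =>
          (1 / l1Norm ((toRealMatrix M ^ t).mulVec v)) • (toRealMatrix M ^ t).mulVec v)
        atTop (𝓝 w) ∧
      w ≠ 0 ∧
      ∃ μ : ℝ, Module.End.HasEigenvector (Matrix.toLin' (toRealMatrix M)) μ w := by
  obtain ⟨r, b, htri, hdiag⟩ := hform
  have hblock : ∀ k, IsPowerBounded (M.toSquareBlock b k) ∨ ∃ lam : ℝ, 1 < lam ∧
      ∀ i j, ∃ c : ℝ, 0 < c ∧
        GrowsLike (fun t => ((M.toSquareBlock b k ^ t) i j : ℝ)) lam 0 c := fun k =>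
    (hdiag k).elim isPowerBounded_or_growsLike_of_isPrimitive Or.inl
  have hpow : ∀ (t : ℕ) i j, (toRealMatrix M ^ t) i j = ((M ^ t) i j : ℝ) := fun t i j => by
    rw [show toRealMatrix M = M.map (Int.castRingHom ℝ) from rfl, ← Matrix.map_pow]
    rfl
  have hN0 : ∀ i j, 0 ≤ toRealMatrix M i j := fun i j => Int.cast_nonneg (hnonneg i j)
  have hNtri : (toRealMatrix M).BlockTriangular (OrderDual.toDual ∘ b) :=
    htri.map (Int.castRingHom ℝ)
  refine exists_tendsto_normalized_orbit hN0 hv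
    (hasGrowth_mulVec_pow hN0 hNtri (fun i j hij => ?_) hv) fun hsub => ?_
  · simp only [hpow]
    rcases hblock (b j) with ⟨K, hK⟩ | ⟨lam, hlam, hg⟩
    -- Power boundedness only concerns exponents t ≥ 1, hence the shift.
    · refine Or.inl (Subexponential.of_shift (Subexponential.of_bounded (K := K) fun t => ?_))
      have h := hK (t + 1) (Nat.le_add_left 1 t) ⟨i, hij⟩ ⟨j, rfl⟩
      rw [BlockTriangular.toSquareBlock_pow_apply htri] at h
      exact_mod_cast h
    · obtain ⟨c, hc, h⟩ := hg ⟨i, hij⟩ ⟨j, rfl⟩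
      simp only [BlockTriangular.toSquareBlock_pow_apply htri] at h
      exact Or.inr ⟨lam, hlam, c, hc, h⟩
  · obtain ⟨i, hi⟩ := Function.ne_iff.1 hv0
    have hi' : 0 < v i := lt_of_le_of_ne (hv i) (Ne.symm hi)
    obtain ⟨l, hl⟩ := hexp.exists_not_subexponential hnonneg htri hblock i
    -- As v i > 0, column i of M^t is bounded by the mass of the orbit divided by v i.
    refine hl ((hsub.const_mul (v i)⁻¹).of_le
      (fun t => by exact_mod_cast matrix_pow_nonneg hnonneg t l i) fun t => ?_)
    rw [le_inv_mul_iff₀ hi', mul_comm, ← hpow]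
    calc (toRealMatrix M ^ t) l i * v i ≤ (toRealMatrix M ^ t).mulVec v l :=
          Finset.single_le_sum (f := fun j => (toRealMatrix M ^ t) l j * v j)
            (fun j _ => mul_nonneg (matrix_pow_nonneg hN0 t l j) (hv j)) (Finset.mem_univ i)
      _ ≤ ∑ m, (toRealMatrix M ^ t).mulVec v m :=
          Finset.single_le_sum (fun m _ =>
            mulVec_nonneg_of_nonneg (matrix_pow_nonneg hN0 t) hv m) (Finset.mem_univ l)
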